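/- All spaces are topological spaces. A Tychonoff space $X$ (completely regular and $T_1$) is a *Lindelöf $\Sigma$-space* if there are a cover $\mathcal C$ of $X$ by compact sets and a countable family $\mathcal F$ of subsets of $X$ such that for all $C\in\mathcal C$ and all open $U\supseteq C$ there is $F\in\mathcal F$ with $C\subseteq F\subseteq U$. A space $Z$ is *discretely Lindelöf* if the closure in $Z$ of every discrete subspace of $Z$ is Lindelöf. The *co-diagonal* of $X$ is the subspace $\Delta_X^c=(X\times X)\setminus\{(x,x):x\in X\}$ of $X\times X$. A *network* of $X$ is a family $\mathcal N$ of subsets of $X$ such that every open subset of $X$ is the union of a subfamily of $\mathcal N$. **Corollary 3.26.** If $X$ is a Lindelöf $\Sigma$-space such that $\Delta_X^c$ is discretely Lindelöf, then $X$ has a countable network. -/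

import Mathlib

/-- A space `X` is discretely Lindelöf if the closure of every discrete subspace of `X` is
Lindelöf. -/
def IsDiscretelyLindelof (X : Type*) [TopologicalSpace X] : Prop :=
  ∀ D : Set X, IsDiscrete D → IsLindelof (closure D)

/-- The co-diagonal of `X`: the complement of the diagonal in `X × X`. As a space it carries the
subspace topology. -/
def coDiagonal (X : Type*) : Set (X × X) := (Set.diagonal X)ᶜ

/-- `F` is a network modulo the family `C`: whenever `K ∈ C` is contained in an open set `U`,
some member of `F` lies between `K` and `U`. -/
def IsNetworkModulo {X : Type*} [TopologicalSpace X] (F C : Set (Set X)) : Prop :=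
  ∀ K ∈ C, ∀ U : Set X, IsOpen U → K ⊆ U → ∃ A ∈ F, K ⊆ A ∧ A ⊆ U

/-- A Lindelöf Σ-space: a Tychonoff space with a countable family of subsets that is a network
modulo some cover by compact sets. -/
structure IsLindelofSigmaSpace (X : Type*) [TopologicalSpace X] : Prop where
  tychonoff : T35Space X
  exists_network : ∃ F C : Set (Set X), F.Countable ∧ (∀ K ∈ C, IsCompact K) ∧
    ⋃₀ C = Set.univ ∧ IsNetworkModulo F C

/-- `N` is a network of `X`: every open set is the union of a subfamily of `N`. -/
def IsNetwork {X : Type*} [TopologicalSpace X] (N : Set (Set X)) : Prop :=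
  ∀ U : Set X, IsOpen U → ∃ M ⊆ N, U = ⋃₀ M

open Set Filter Topology

/-! By compactness, a countable network modulo compact sets yields a countable network once
countably many continuous functions separate the pairs in a common `K ∈ C`. Discrete Lindelöfness
supplies such functions on the closure of any discrete subset of the co-diagonal. Hence discrete
subsets of `X` are countable, and a transfinite recursion then separates each point from all others,
so the filters `outerNhds` are countably generated.

If a set of such pairs were not countably separated, a recursion of length ω₁ would give a discrete
sequence of off-diagonal pairs, each avoiding the functions attached to the refined closures of
earlier segments. An off-diagonal cluster point, already adherent to a countable segment, gives a
contradiction. So only refined closures of countable sets `T` matter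
(`isCountablySeparated_of_outerClosure`).

The coordinates of `T` form a countable set `Q`, whose points are distinguished by a continuous
pseudometric `ρ`. Adherent pairs with `ρ = 0` yield to the same reduction: countably many of them
lie in the closure of a discrete set of pairs from `Q` with `ρ` tending to `0`. -/

/-- Countably many continuous real functions separate the coordinates of every off-diagonal
pair in `S`. -/
def IsCountablySeparated {X : Type*} [TopologicalSpace X] (S : Set (X × X)) : Prop :=
  ∃ A : Set C(X, ℝ), A.Countable ∧ ∀ p ∈ S, p.1 ≠ p.2 → ∃ f ∈ A, f p.1 ≠ f p.2

/-- The filter generated by the members of `F` that contain `K`. -/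
def outerFilter {X : Type*} (F : Set (Set X)) (K : Set X) : Filter X :=
  Filter.generate {A ∈ F | K ⊆ A}

/-- The neighborhoods of `x` refined by the members of `F` that contain `K`. -/
def outerNhds {X : Type*} [TopologicalSpace X] (F : Set (Set X)) (K : Set X) (x : X) : Filter X :=
  𝓝 x ⊓ outerFilter F K

/-- Pairs of points of a common `K ∈ C` that are adherent to `T` in the refined topology. -/
def outerClosure {X : Type*} [TopologicalSpace X] (F C : Set (Set X)) (T : Set (X × X)) :
    Set (X × X) :=
  {p | ∃ K ∈ C, p.1 ∈ K ∧ p.2 ∈ K ∧ (outerNhds F K p.1 ×ˢ outerNhds F K p.2 ⊓ 𝓟 T).NeBot}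

/-! ### Countable separation from discrete Lindelöfness -/

section Separation

variable {X : Type*} [TopologicalSpace X]

theorem IsCountablySeparated.mono {S T : Set (X × X)} (hT : IsCountablySeparated T)
    (h : ∀ p ∈ S, p.1 ≠ p.2 → p ∈ T) : IsCountablySeparated S := by
  obtain ⟨A, hA, hsep⟩ := hT
  exact ⟨A, hA, fun p hp hne => hsep p (h p hp hne) hne⟩

theorem IsCountablySeparated.union {S T : Set (X × X)} (hS : IsCountablySeparated S)
    (hT : IsCountablySeparated T) : IsCountablySeparated (S ∪ T) := by
  obtain ⟨A, hA, hSA⟩ := hS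
  obtain ⟨B, hB, hTB⟩ := hT
  refine ⟨A ∪ B, hA.union hB, ?_⟩
  rintro p (hp | hp) hne
  · obtain ⟨f, hf, h⟩ := hSA p hp hne
    exact ⟨f, Or.inl hf, h⟩
  · obtain ⟨f, hf, h⟩ := hTB p hp hne
    exact ⟨f, Or.inr hf, h⟩

theorem IsCountablySeparated.biUnion {ι : Type*} {s : Set ι} (hs : s.Countable)
    {S : ι → Set (X × X)} (h : ∀ i ∈ s, IsCountablySeparated (S i)) :
    IsCountablySeparated (⋃ i ∈ s, S i) := by
  choose! A hA hsep using h
  refine ⟨⋃ i ∈ s, A i, hs.biUnion hA, fun p hp hne => ?_⟩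
  simp only [mem_iUnion] at hp
  obtain ⟨i, hi, hpi⟩ := hp
  obtain ⟨f, hf, h⟩ := hsep i hi p hpi hne
  exact ⟨f, mem_biUnion hi hf, h⟩

theorem isCountablySeparated_ne (f : C(X, ℝ)) :
    IsCountablySeparated {p : X × X | f p.1 ≠ f p.2} :=
  ⟨{f}, countable_singleton f, fun _ hp _ => ⟨f, rfl, hp⟩⟩

theorem isOpen_ne_apply (f : C(X, ℝ)) : IsOpen {p : X × X | f p.1 ≠ f p.2} :=
  isOpen_ne_fun (by fun_prop) (by fun_prop)

theorem exists_continuousMap_separating_closed [CompletelyRegularSpace X] {x : X} {K : Set X}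
    (hK : IsClosed K) (hx : x ∉ K) : ∃ f : C(X, ℝ), ∀ y ∈ K, f x ≠ f y := by
  obtain ⟨f, hf, hfx, hfK⟩ := CompletelyRegularSpace.completely_regular x K hK hx
  refine ⟨⟨fun z => (f z : ℝ), by fun_prop⟩, fun y hy => ?_⟩
  have := hfK hy
  simp [hfx, this]

theorem exists_continuousMap_ne [T35Space X] {x y : X} (h : x ≠ y) :
    ∃ f : C(X, ℝ), f x ≠ f y := by
  obtain ⟨f, hf⟩ := exists_continuousMap_separating_closed (x := x) (K := {y}) isClosed_singleton h
  exact ⟨f, hf y rfl⟩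

theorem IsCountablySeparated.of_countable [T35Space X] {S : Set (X × X)} (hS : S.Countable) :
    IsCountablySeparated S := by
  have h : ∀ p : X × X, p.1 ≠ p.2 → ∃ f : C(X, ℝ), f p.1 ≠ f p.2 :=
    fun p hp => exists_continuousMap_ne hp
  choose! f hf using h
  exact ⟨f '' S, hS.image f, fun p hp hne => ⟨f p, mem_image_of_mem f hp, hf p hne⟩⟩

/-- The closure in the co-diagonal of a discrete set is countably separated. -/
theorem IsDiscretelyLindelof.isCountablySeparated_closure [T35Space X]
    (hΔ : IsDiscretelyLindelof (coDiagonal X)) {E : Set (coDiagonal X)} (hE : IsDiscrete E) :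
    IsCountablySeparated (Subtype.val '' closure E) := by
  -- The open sets on which some `f` distinguishes the coordinates cover the co-diagonal.
  obtain ⟨A, hA, hcov⟩ := (hΔ E hE).elim_countable_subcover
    (fun f : C(X, ℝ) => Subtype.val ⁻¹' {p : X × X | f p.1 ≠ f p.2})
    (fun f => (isOpen_ne_apply f).preimage continuous_subtype_val) (fun z _ => by
      obtain ⟨f, hf⟩ := exists_continuousMap_ne z.2
      exact mem_iUnion.2 ⟨f, hf⟩)
  refine ⟨A, hA, ?_⟩
  rintro _ ⟨z, hz, rfl⟩ -
  simpa using hcov hz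

theorem IsDiscretelyLindelof.isCountablySeparated_closure_prod [T35Space X]
    (hΔ : IsDiscretelyLindelof (coDiagonal X)) {D : Set X} (hD : IsDiscrete D) :
    IsCountablySeparated (closure D ×ˢ closure D) := by
  have hE : IsDiscrete {z : coDiagonal X | z.1.1 ∈ D ∧ z.1.2 ∈ D} := by
    rw [isDiscrete_iff_forall_mem_exists_isOpen] at hD ⊢
    rintro ⟨⟨a, b⟩, hab⟩ ⟨ha, hb⟩
    obtain ⟨U, hU, hUD⟩ := hD a ha
    obtain ⟨V, hV, hVD⟩ := hD b hb
    refine ⟨Subtype.val ⁻¹' (U ×ˢ V), (hU.prod hV).preimage continuous_subtype_val, ?_⟩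
    have haU : a ∈ U := (hUD.symm.subset rfl).1
    have hbV : b ∈ V := (hVD.symm.subset rfl).1
    refine Subset.antisymm ?_ ?_
    · rintro ⟨⟨c, d⟩, hcd⟩ ⟨⟨hcU, hdV⟩, hc, hd⟩
      have h1 : c = a := hUD.subset ⟨hcU, hc⟩
      have h2 : d = b := hVD.subset ⟨hdV, hd⟩
      subst h1 h2
      rfl
    · rintro _ rfl
      exact ⟨⟨haU, hbV⟩, ha, hb⟩
  refine (hΔ.isCountablySeparated_closure hE).mono ?_
  rintro ⟨x, y⟩ ⟨hx, hy⟩ hne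
  refine ⟨⟨(x, y), hne⟩, ?_, rfl⟩
  have hxy : (x, y) ∈ closure (D ×ˢ D) := by
    rw [closure_prod_eq]
    exact ⟨hx, hy⟩
  rw [mem_closure_iff] at hxy ⊢
  intro O hO hmem
  obtain ⟨O', hO', rfl⟩ := isOpen_induced_iff.1 hO
  have hopen : IsOpen (coDiagonal X) := isClosed_diagonal.isOpen_compl
  obtain ⟨p, ⟨hpO, hpne⟩, hpD⟩ := hxy (O' ∩ coDiagonal X) (hO'.inter hopen) ⟨hmem, hne⟩
  exact ⟨⟨p, hpne⟩, hpO, hpD⟩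

end Separation

/-! ### Discrete sequences by transfinite recursion -/

section Recursion

/-- A set enumerated along a well-order so that each term avoids the closure of the earlier terms
and a neighborhood assigned to each of them is discrete. -/
theorem isDiscrete_image_of_separated {Z ι : Type*} [TopologicalSpace Z] [LinearOrder ι]
    {U : Z → Set Z} (hU : ∀ z, IsOpen (U z)) (hmem : ∀ z, z ∈ U z) {r : ι → Z} {J : Set ι}
    (hcl : ∀ i ∈ J, r i ∉ closure (r '' {j ∈ J | j < i}))
    (hUr : ∀ i ∈ J, ∀ j ∈ J, j < i → r i ∉ U (r j)) : IsDiscrete (r '' J) := by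
  rw [isDiscrete_iff_forall_mem_exists_isOpen]
  rintro _ ⟨i, hi, rfl⟩
  refine ⟨U (r i) ∩ (closure (r '' {j ∈ J | j < i}))ᶜ, (hU _).inter isClosed_closure.isOpen_compl,
    Subset.antisymm ?_ ?_⟩
  · rintro _ ⟨⟨hU', hc⟩, j, hj, rfl⟩
    rcases lt_trichotomy j i with h | rfl | h
    · exact absurd (subset_closure (mem_image_of_mem r (show j ∈ {j ∈ J | j < i} from ⟨hj, h⟩))) hc
    · rfl
    · exact absurd hU' (hUr j hj i hi h)
  · rintro _ rfl
    exact ⟨⟨hmem _, hcl i hi⟩, mem_image_of_mem r hi⟩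

/-- If no countable union of sets `Ψ E`, with `E ⊆ S` countable and discrete, covers `S`, then `S`
contains a discrete sequence each of whose terms avoids `Ψ` of all earlier initial segments. -/
theorem exists_discrete_sequence {Z ι : Type*} [TopologicalSpace Z] [LinearOrder ι]
    [WellFoundedLT ι] (hι : ∀ i : ι, (Iio i).Countable)
    {U : Z → Set Z} (hU : ∀ z, IsOpen (U z)) (hmem : ∀ z, z ∈ U z) {Ψ : Set Z → Set Z}
    (hcl : ∀ E, closure E ⊆ Ψ E) (hUΨ : ∀ E, ∀ e ∈ E, U e ⊆ Ψ E) {S : Set Z}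
    (h : ∀ 𝓔 : Set (Set Z), 𝓔.Countable → (∀ E ∈ 𝓔, E ⊆ S ∧ E.Countable ∧ IsDiscrete E) →
      ∃ z ∈ S, ∀ E ∈ 𝓔, z ∉ Ψ E) :
    ∃ r : ι → Z, (∀ i, r i ∈ S) ∧ (∀ i, ∀ j ≤ i, r i ∉ Ψ (r '' Iio j)) ∧
      IsDiscrete (range r) ∧ Function.Injective r := by
  classical
  obtain ⟨z₀, -, -⟩ := h ∅ countable_empty (by simp)
  -- Since `Ψ` need not be monotone, all initial segments up to `i` are avoided, not just the last.
  -- The default `z₀` is never used, as `hgood` shows.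
  let step : (i : ι) → ((j : ι) → j < i → Z) → Z := fun i g =>
    if hz : ∃ z ∈ S, ∀ j ≤ i, z ∉ Ψ {w | ∃ k, ∃ hk : k < i, k < j ∧ g k hk = w}
    then hz.choose else z₀
  let r : ι → Z := WellFoundedLT.fix step
  have hr : ∀ i, r i = step i (fun j _ => r j) := fun i => WellFoundedLT.fix_eq step i
  have himg : ∀ i, ∀ j ≤ i, {w | ∃ k, ∃ _ : k < i, k < j ∧ r k = w} = r '' Iio j := by
    intro i j hji
    ext w
    constructor
    · rintro ⟨k, -, hkj, rfl⟩
      exact ⟨k, hkj, rfl⟩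
    · rintro ⟨k, hkj, rfl⟩
      exact ⟨k, lt_of_lt_of_le hkj hji, hkj, rfl⟩
  have hdisc : ∀ J : Set ι, (∀ i ∈ J, ∀ j < i, j ∈ J) →
      (∀ i ∈ J, ∀ j ≤ i, r i ∉ Ψ (r '' Iio j)) → IsDiscrete (r '' J) := by
    intro J hJ hgood
    refine isDiscrete_image_of_separated hU hmem (fun i hi hc => hgood i hi i le_rfl ?_)
      (fun i hi j hj hji hmemU => hgood i hi i le_rfl ?_)
    · exact hcl _ (closure_mono (image_mono fun j hj => hj.2) hc)
    · exact hUΨ _ (r j) (mem_image_of_mem r hji) hmemU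
  have hgood : ∀ i, r i ∈ S ∧ ∀ j ≤ i, r i ∉ Ψ (r '' Iio j) := by
    intro i
    induction i using WellFoundedLT.induction with
    | _ i ih =>
      have hz : ∃ z ∈ S, ∀ j ≤ i, z ∉ Ψ {w | ∃ k, ∃ _ : k < i, k < j ∧ r k = w} := by
        obtain ⟨z, hzS, hz⟩ := h ((fun j => r '' Iio j) '' Iic i) (by
            refine Countable.image ?_ _
            rw [← Iio_insert]
            exact (hι i).insert i) (by
            rintro _ ⟨j, hj, rfl⟩
            refine ⟨?_, (hι j).image r, hdisc _ (fun a ha b hb => lt_trans hb ha) ?_⟩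
            · rintro _ ⟨k, hk, rfl⟩
              exact (ih k (lt_of_lt_of_le hk hj)).1
            · exact fun k hk => (ih k (lt_of_lt_of_le hk hj)).2)
        refine ⟨z, hzS, fun j hj => ?_⟩
        rw [himg i j hj]
        exact hz _ ⟨j, hj, rfl⟩
      have hri : r i = hz.choose := by
        rw [hr i]
        exact dif_pos hz
      refine ⟨hri ▸ hz.choose_spec.1, fun j hj => ?_⟩
      rw [hri, ← himg i j hj]
      exact hz.choose_spec.2 j hj
  refine ⟨r, fun i => (hgood i).1, fun i => (hgood i).2, ?_, ?_⟩
  · rw [← image_univ]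
    exact hdisc univ (fun _ _ _ _ => mem_univ _) fun i _ => (hgood i).2
  · intro i j hij
    by_contra hne
    wlog hlt : i < j generalizing i j
    · exact this hij.symm (Ne.symm hne) (lt_of_le_of_ne (not_lt.1 hlt) (Ne.symm hne))
    exact (hgood j).2 j le_rfl (hcl _ (subset_closure ⟨i, hlt, hij⟩))

theorem exists_uncountable_wellOrder_countable_Iio :
    ∃ (ι : Type) (_ : LinearOrder ι), WellFoundedLT ι ∧ Uncountable ι ∧
      ∀ i : ι, (Iio i).Countable := by
  refine ⟨(Cardinal.aleph 1).ord.ToType, inferInstance, inferInstance, ?_, fun i => ?_⟩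
  · rw [← Cardinal.aleph0_lt_mk_iff, Cardinal.mk_ord_toType]
    exact Cardinal.aleph0_lt_aleph_one
  · rw [← Cardinal.le_aleph0_iff_set_countable, ← Cardinal.lt_aleph_one_iff]
    simpa using Cardinal.mk_Iio_lt i (by simp)

end Recursion

/-! ### Compactness, spread and countable character of the refined filters -/

/-- A countable network `F` modulo a cover `C` by compact sets. -/
structure IsSigmaNetwork {X : Type*} [TopologicalSpace X] (F C : Set (Set X)) : Prop where
  countable : F.Countable
  isCompact : ∀ K ∈ C, IsCompact K
  sUnion_eq : ⋃₀ C = univ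
  isNetworkModulo : IsNetworkModulo F C

namespace IsSigmaNetwork

variable {X : Type*} [TopologicalSpace X] {F C : Set (Set X)}

theorem exists_mem (h : IsSigmaNetwork F C) (x : X) : ∃ K ∈ C, x ∈ K := by
  simpa using h.sUnion_eq.symm.subset (mem_univ x)

theorem isCountablyGenerated_outerFilter (h : IsSigmaNetwork F C) (K : Set X) :
    (outerFilter F K).IsCountablyGenerated :=
  ⟨_, h.countable.mono (sep_subset _ _), rfl⟩

/-- Otherwise finitely many open sets outside `u` cover `K`, and a member of `F` between `K` and
their union puts that union in `u`. -/
theorem exists_le_nhds (h : IsSigmaNetwork F C) {K : Set X} (hK : K ∈ C) {u : Ultrafilter X}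
    (hu : ↑u ≤ outerFilter F K) : ∃ x ∈ K, ↑u ≤ 𝓝 x := by
  by_contra! hcon
  have hO : ∀ x ∈ K, ∃ O, IsOpen O ∧ x ∈ O ∧ O ∉ u := by
    intro x hx
    obtain ⟨O, hO, hOu⟩ := Filter.not_le.1 (hcon x hx)
    obtain ⟨V, hVO, hV, hxV⟩ := mem_nhds_iff.1 hO
    exact ⟨V, hV, hxV, fun hVu => hOu (mem_of_superset hVu hVO)⟩
  choose! O hOo hxO hOu using hO
  obtain ⟨t, htK, hcov⟩ := (h.isCompact K hK).elim_nhds_subcover O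
    fun x hx => (hOo x hx).mem_nhds (hxO x hx)
  obtain ⟨A, hA, hKA, hAO⟩ := h.isNetworkModulo K hK (⋃ x ∈ t, O x)
    (isOpen_biUnion fun x hx => hOo x (htK x hx)) hcov
  have hmem : (⋃ x ∈ t, O x) ∈ u :=
    mem_of_superset (hu (mem_generate_of_mem ⟨hA, hKA⟩)) hAO
  obtain ⟨x, hx, hxu⟩ := (Ultrafilter.finite_biUnion_mem_iff t.finite_toSet).1 hmem
  exact hOu x (htK x hx) hxu

/-- If countably many functions separate the points of `K ∩ Y` for each `K ∈ C`, where `Y` is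
closed, then `Y` has a countable network. -/
theorem exists_countable_network (h : IsSigmaNetwork F C) {Y : Set X} (hY : IsClosed Y)
    (hsep : IsCountablySeparated {p : X × X | ∃ K ∈ C, (p.1 ∈ K ∧ p.1 ∈ Y) ∧ p.2 ∈ K ∧ p.2 ∈ Y}) :
    ∃ N : Set (Set X), N.Countable ∧
      ∀ x ∈ Y, ∀ U ∈ 𝓝 x, ∃ A ∈ N, x ∈ A ∧ A ∩ Y ⊆ U := by
  obtain ⟨A, hA, hsep⟩ := hsep
  let B : Set (Set X) := F ∪ ⋃ f ∈ A, preimage f '' TopologicalSpace.countableBasis ℝ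
  have hB : B.Countable := h.countable.union
    (hA.biUnion fun f _ => (TopologicalSpace.countable_countableBasis ℝ).image _)
  refine ⟨sInter '' {t | t.Finite ∧ t ⊆ B}, (countable_ofPred_finite_subset hB).image _, ?_⟩
  intro x hxY U hU
  obtain ⟨K, hK, hxK⟩ := h.exists_mem x
  have hle : generate {s ∈ B | x ∈ s} ⊓ 𝓟 Y ≤ 𝓝 x := by
    rw [le_iff_ultrafilter]
    intro u hu
    obtain ⟨hu, huY⟩ := le_inf_iff.1 hu
    obtain ⟨y, hyK, hy⟩ := h.exists_le_nhds hK (u := u) (le_generate_iff.2 fun s hs =>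
      hu (mem_generate_of_mem ⟨Or.inl hs.1, hs.2 hxK⟩))
    have hyY : y ∈ Y := hY.mem_of_tendsto (f := id) hy (le_principal_iff.1 huY)
    by_contra hne
    have hxy : x ≠ y := by
      rintro rfl
      exact hne hy
    obtain ⟨f, hf, hfxy⟩ := hsep (x, y) ⟨K, hK, ⟨hxK, hxY⟩, hyK, hyY⟩ hxy
    have h1 : Tendsto f u (𝓝 (f y)) := (f.continuous.tendsto y).mono_left hy
    have h2 : Tendsto f u (𝓝 (f x)) := by
      intro V hV
      obtain ⟨W, hW, hxW, hWV⟩ :=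
        (TopologicalSpace.isBasis_countableBasis ℝ).mem_nhds_iff.1 hV
      refine mem_of_superset (hu (mem_generate_of_mem ⟨Or.inr ?_, ?_⟩)) (preimage_mono hWV)
      · exact mem_biUnion hf (mem_image_of_mem _ hW)
      · exact hxW
    exact hfxy (tendsto_nhds_unique h2 h1)
  obtain ⟨t, hts, htf, htV⟩ := mem_generate_iff.1 (mem_inf_principal.1 (hle hU))
  exact ⟨⋂₀ t, ⟨t, ⟨htf, fun s hs => (hts hs).1⟩, rfl⟩, fun s hs => (hts hs).2,
    fun z hz => htV hz.1 hz.2⟩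

/-- The closure of `D` has a countable network, and distinct points of `D` need distinct isolating
members. -/
theorem countable_of_isDiscrete [T35Space X] (h : IsSigmaNetwork F C)
    (hΔ : IsDiscretelyLindelof (coDiagonal X)) {D : Set X} (hD : IsDiscrete D) : D.Countable := by
  obtain ⟨N, hN, hnet⟩ := h.exists_countable_network (isClosed_closure (s := D))
    ((hΔ.isCountablySeparated_closure_prod hD).mono fun p ⟨_, _, hp, hq⟩ _ => ⟨hp.2, hq.2⟩)
  have hA : ∀ x ∈ D, ∃ A ∈ N, x ∈ A ∧ A ∩ D ⊆ {x} := by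
    intro x hx
    obtain ⟨U, hU, hUD⟩ := nhds_inter_eq_singleton_of_mem_discrete hD hx
    obtain ⟨A, hAN, hxA, hAU⟩ := hnet x (subset_closure hx) U hU
    exact ⟨A, hAN, hxA, fun z hz => hUD.subset ⟨hAU ⟨hz.1, subset_closure hz.2⟩, hz.2⟩⟩
  choose! A hAN hxA hAD using hA
  refine MapsTo.countable_of_injOn (f := A) (t := N) hAN (fun x hx y hy hxy => ?_) hN
  exact hAD y hy ⟨hxy ▸ hxA x hx, hx⟩

/-- Each point is separated from all the others by countably many continuous functions. -/
theorem isCountablySeparated_singleton_prod [T35Space X] (h : IsSigmaNetwork F C)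
    (hΔ : IsDiscretelyLindelof (coDiagonal X)) (x : X) :
    IsCountablySeparated ({x} ×ˢ (univ : Set X)) := by
  by_contra hcon
  have hf : ∀ z : X, ∃ f : C(X, ℝ), z ≠ x → f x ≠ f z := by
    intro z
    by_cases hz : z = x
    · exact ⟨0, fun hne => absurd hz hne⟩
    · obtain ⟨f, hf⟩ := exists_continuousMap_ne (Ne.symm hz)
      exact ⟨f, fun _ => hf⟩
  choose f hf using hf
  let U : X → Set X := fun z => {w | z ≠ x → f z x ≠ f z w}
  have hU : ∀ z, IsOpen (U z) := by
    intro z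
    by_cases hz : z = x
    · simp [U, hz]
    · simpa [U, hz] using isOpen_ne_fun (f := fun _ : X => f z x) (g := f z) (by fun_prop)
        (by fun_prop)
  obtain ⟨ι, _, hwf, hunc, hι⟩ := exists_uncountable_wellOrder_countable_Iio
  obtain ⟨r, -, -, hdisc, hinj⟩ := exists_discrete_sequence hι hU (fun z => hf z)
    (Ψ := fun E => closure E ∪ ⋃ e ∈ E, U e) (fun E => subset_union_left)
    (fun E e he => (subset_biUnion_of_mem (u := U) he).trans subset_union_right)
    (S := {x}ᶜ) (by
      intro 𝓔 h𝓔 hE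
      by_contra! hcov
      refine hcon ((IsCountablySeparated.biUnion (S := fun E => {x} ×ˢ (closure E ∪ ⋃ e ∈ E, U e))
        h𝓔 fun E hE𝓔 => ?_).mono ?_)
      · obtain ⟨hEx, hEc, hEd⟩ := hE E hE𝓔
        rw [prod_union]
        refine IsCountablySeparated.union ?_ ?_
        · by_cases hx : x ∈ closure E
          · exact (hΔ.isCountablySeparated_closure_prod hEd).mono
              fun p hp _ => ⟨by rw [show p.1 = x from hp.1]; exact hx, hp.2⟩
          · obtain ⟨g, hg⟩ := exists_continuousMap_separating_closed isClosed_closure hx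
            exact (isCountablySeparated_ne g).mono fun p hp _ => by
              rw [mem_ofPred_eq, show p.1 = x from hp.1]
              exact hg _ hp.2
        · refine (IsCountablySeparated.biUnion hEc fun e _ =>
            isCountablySeparated_ne (f e)).mono fun p hp _ => ?_
          obtain ⟨e, he, hpe⟩ := mem_iUnion₂.1 hp.2
          refine mem_biUnion he ?_
          rw [mem_ofPred_eq, show p.1 = x from hp.1]
          exact hpe (hEx he)
      · rintro ⟨a, z⟩ ⟨rfl, -⟩ hne
        obtain ⟨E, hE𝓔, hz⟩ := hcov z (Ne.symm hne)
        exact mem_biUnion hE𝓔 ⟨rfl, hz⟩)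
  exact not_countable (countable_univ_iff.1 (countable_of_injective_of_countable_image hinj.injOn
    (by simpa using h.countable_of_isDiscrete hΔ hdisc)))

/-- Modulo `outerFilter F K`, the neighborhoods of `x` are determined by countably many functions
separating `x` from the rest: an ultrafilter finer than both converges in `K`, and only to `x`. -/
theorem isCountablyGenerated_outerNhds [T35Space X] (h : IsSigmaNetwork F C)
    (hΔ : IsDiscretelyLindelof (coDiagonal X)) {K : Set X} (hK : K ∈ C) (x : X) :
    (outerNhds F K x).IsCountablyGenerated := by
  obtain ⟨A, hA, hsep⟩ := h.isCountablySeparated_singleton_prod hΔ x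
  have := h.isCountablyGenerated_outerFilter K
  have := hA.to_subtype
  have heq : outerNhds F K x = (⨅ f : A, comap f.1 (𝓝 (f.1 x))) ⊓ outerFilter F K := by
    refine le_antisymm (inf_le_inf_right _ (le_iInf fun f =>
      tendsto_iff_comap.1 (f.1.continuous.tendsto x))) (le_inf ?_ inf_le_right)
    rw [le_iff_ultrafilter]
    intro u hu
    obtain ⟨hu, huK⟩ := le_inf_iff.1 hu
    obtain ⟨y, -, hy⟩ := h.exists_le_nhds hK huK
    by_contra hne
    have hxy : x ≠ y := by
      rintro rfl
      exact hne hy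
    obtain ⟨f, hf, hfxy⟩ := hsep (x, y) ⟨rfl, mem_univ y⟩ hxy
    exact hfxy (tendsto_nhds_unique (tendsto_iff_comap.2 (hu.trans
        (iInf_le (fun f : A => comap f.1 (𝓝 (f.1 x))) ⟨f, hf⟩)))
      ((f.continuous.tendsto y).mono_left hy))
  rw [heq]
  infer_instance

/-- A filter of pairs closed under countable intersections and concentrated on pairs with both
coordinates in a common member of `C` has a cluster point in the refined topology. -/
theorem exists_clusterPt (h : IsSigmaNetwork F C) (l : Filter (X × X)) [l.NeBot]
    [CountableInterFilter l] (hl : ∀ᶠ p in l, ∃ K ∈ C, p.1 ∈ K ∧ p.2 ∈ K) :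
    ∃ K ∈ C, ∃ x ∈ K, ∃ y ∈ K, (l ⊓ (outerNhds F K x ×ˢ outerNhds F K y)).NeBot := by
  -- A typical `p` avoids the countably many negligible squares `⋂₀ t ×ˢ ⋂₀ t`; any `K` containing
  -- its coordinates then works.
  have hev : ∀ᶠ p in l, ∀ t ∈ {t | t.Finite ∧ t ⊆ F},
      (∀ᶠ q in l, q ∉ ⋂₀ t ×ˢ ⋂₀ t) → p ∉ ⋂₀ t ×ˢ ⋂₀ t := by
    rw [eventually_countable_ball (countable_ofPred_finite_subset h.countable)]
    intro t _
    by_cases ht : ∀ᶠ q in l, q ∉ ⋂₀ t ×ˢ ⋂₀ t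
    · exact ht.mono fun p hp _ => hp
    · exact Eventually.of_forall fun p hp => absurd hp ht
  obtain ⟨p, hp, K, hK, hp1, hp2⟩ := (hev.and hl).exists
  have hne : (l ⊓ (outerFilter F K ×ˢ outerFilter F K)).NeBot := by
    rw [inf_neBot_iff_frequently_right]
    intro q hq
    obtain ⟨V, hV, hVq⟩ := mem_prod_self_iff.1 hq
    obtain ⟨t, hts, htf, htV⟩ := mem_generate_iff.1 hV
    refine Frequently.mono (p := fun z => z ∈ ⋂₀ t ×ˢ ⋂₀ t) (fun hcon => ?_)
      fun z hz => hVq (prod_mono htV htV hz)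
    exact hp t ⟨htf, fun s hs => (hts hs).1⟩ hcon
      ⟨fun s hs => (hts hs).2 hp1, fun s hs => (hts hs).2 hp2⟩
  let u := Ultrafilter.of (l ⊓ (outerFilter F K ×ˢ outerFilter F K))
  obtain ⟨hul, huF⟩ := le_inf_iff.1 (Ultrafilter.of_le (l ⊓ (outerFilter F K ×ˢ outerFilter F K)))
  have h1 : ↑(u.map Prod.fst) ≤ outerFilter F K := (tendsto_fst (g := outerFilter F K)).mono_left huF
  have h2 : ↑(u.map Prod.snd) ≤ outerFilter F K := (tendsto_snd (f := outerFilter F K)).mono_left huF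
  obtain ⟨x, hx, hux⟩ := h.exists_le_nhds hK h1
  obtain ⟨y, hy, huy⟩ := h.exists_le_nhds hK h2
  refine ⟨K, hK, x, hx, y, hy, u.neBot.mono (le_inf hul ?_)⟩
  have h3 : Tendsto Prod.fst (u : Filter (X × X)) (outerNhds F K x) := le_inf hux h1
  have h4 : Tendsto Prod.snd (u : Filter (X × X)) (outerNhds F K y) := le_inf huy h2
  exact h3.prodMk h4

end IsSigmaNetwork

/-! ### Approximating zeros of `ρ` by a discrete set of pairs -/

/-- The common zero set of the differences `f p.1 - f p.2`, for countably many `f`, is the zero set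
of one continuous function on `X × X`. -/
theorem exists_continuousMap_eq_zero_iff {X : Type*} [TopologicalSpace X] {A : Set C(X, ℝ)}
    (hA : A.Countable) :
    ∃ ρ : C(X × X, ℝ), ∀ p, 0 ≤ ρ p ∧ (ρ p = 0 ↔ ∀ f ∈ A, f p.1 = f p.2) := by
  have := hA.to_subtype
  let _ := TopologicalSpace.metrizableSpaceMetric (A → ℝ)
  have hφ : Continuous fun (x : X) (f : A) => f.1 x := by fun_prop
  refine ⟨⟨fun p => dist (fun f : A => f.1 p.1) (fun f : A => f.1 p.2),
    (hφ.comp continuous_fst).dist (hφ.comp continuous_snd)⟩, fun p => ⟨dist_nonneg, ?_⟩⟩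
  simp [dist_eq_zero, funext_iff]

/-- A countable set of pairs on which a continuous `ρ` vanishes, each of them being a limit along a
countably generated filter of pairs with `0 < ρ`, lies in the closure of a discrete set of
off-diagonal pairs. -/
theorem exists_isDiscrete_subset_closure {X : Type*} [TopologicalSpace X] [T2Space X]
    (ρ : C(X × X, ℝ)) {T : Set (X × X)} (hT : T.Countable) (hρ : ∀ p ∈ T, ρ p = 0)
    (g : X × X → Filter (X × X)) (hg : ∀ p ∈ T, g p ≤ 𝓝 p) (hne : ∀ p ∈ T, (g p).NeBot)
    (hgen : ∀ p ∈ T, (g p).IsCountablyGenerated)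
    (hpos : ∀ p ∈ T, ∀ᶠ q in g p, 0 < ρ q ∧ q.1 ≠ q.2) :
    ∃ E : Set (coDiagonal X), IsDiscrete E ∧ T ⊆ closure (Subtype.val '' E) := by
  have := hT.to_subtype
  obtain ⟨c, hc⟩ := exists_injective_nat T
  have hbasis : ∀ t : T, ∃ B : ℕ → Set (X × X), (g t).HasAntitoneBasis B := fun t => by
    have := hgen t t.2
    exact (g t).exists_antitone_basis
  choose B hB using hbasis
  -- The bound involves both indices, so only finitely many chosen pairs have `ρ` above a given
  -- positive level.
  have hex : ∀ (t : T) (k : ℕ), ∃ z : coDiagonal X, z.1 ∈ B t k ∧ 0 < ρ z ∧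
      ρ z < 1 / ((c t + k : ℕ) + 1) := by
    intro t k
    have := hne t t.2
    have hlt : ∀ᶠ q in g t, ρ q < 1 / ((c t + k : ℕ) + 1) := by
      refine hg t t.2 (ρ.continuous.continuousAt.eventually_lt continuousAt_const ?_)
      rw [hρ t t.2]
      positivity
    obtain ⟨q, hqB, ⟨hq0, hqne⟩, hq1⟩ :=
      (Filter.Eventually.and ((hB t).1.mem_of_mem trivial : B t k ∈ g t)
        ((hpos t t.2).and hlt)).exists
    exact ⟨⟨q, hqne⟩, hqB, hq0, hq1⟩
  choose e heB he0 he1 using hex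
  refine ⟨range fun n : T × ℕ => e n.1 n.2, ?_, ?_⟩
  · rw [isDiscrete_iff_forall_mem_exists_isOpen]
    rintro _ ⟨⟨t, k⟩, rfl⟩
    set z := e t k with hz
    obtain ⟨N, hN⟩ := exists_nat_one_div_lt (half_pos (he0 t k))
    let O : Set (coDiagonal X) := {w | ρ z / 2 < ρ w}
    have hO : IsOpen O := isOpen_lt continuous_const (by fun_prop)
    have hfin : (O ∩ range fun n : T × ℕ => e n.1 n.2).Finite := by
      have hinj : Function.Injective fun n : T × ℕ => (c n.1, n.2) := by
        rintro ⟨a, i⟩ ⟨b, j⟩ hab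
        simp only [Prod.mk.injEq] at hab
        exact Prod.ext (hc hab.1) hab.2
      refine ((((finite_Iio N).prod (finite_Iio N)).preimage
        hinj.injOn).image fun n : T × ℕ => e n.1 n.2).subset ?_
      rintro _ ⟨hw, ⟨s, m⟩, rfl⟩
      refine mem_image_of_mem (fun n : T × ℕ => e n.1 n.2) (x := (s, m)) ?_
      have hlt : c s + m < N := by
        by_contra! hle
        have h1 : 1 / (((c s + m : ℕ) : ℝ) + 1) ≤ 1 / ((N : ℝ) + 1) :=
          one_div_le_one_div_of_le (by positivity) (by gcongr)
        have h2 : ρ z / 2 < ρ (e s m) := hw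
        linarith [he1 s m]
      exact ⟨show c s < N by omega, show m < N by omega⟩
    refine ⟨O \ ((O ∩ range fun n : T × ℕ => e n.1 n.2) \ {z}),
      hO.sdiff (hfin.subset sdiff_subset).isClosed, Subset.antisymm ?_ ?_⟩
    · rintro w ⟨⟨hwO, hw⟩, hwE⟩
      by_contra hwz
      exact hw ⟨⟨hwO, hwE⟩, hwz⟩
    · rintro _ rfl
      exact ⟨⟨half_lt_self (he0 t k), fun hcon => hcon.2 rfl⟩, ⟨(t, k), rfl⟩⟩
  · intro p hp
    have hlim : Tendsto (fun k => (e ⟨p, hp⟩ k).1) atTop (𝓝 p) :=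
      ((hB ⟨p, hp⟩).tendsto fun k => heB ⟨p, hp⟩ k).mono_right (hg p hp)
    exact mem_closure_of_tendsto hlim (Eventually.of_forall fun k =>
      mem_image_of_mem _ ⟨(⟨p, hp⟩, k), rfl⟩)

/-! ### Reduction to countable sets of pairs -/

namespace IsSigmaNetwork

variable {X : Type*} [TopologicalSpace X] {F C : Set (Set X)}

/-- A set of pairs is countably separated if the refined closures of its countable subsets are. -/
theorem isCountablySeparated_of_outerClosure [T35Space X] (h : IsSigmaNetwork F C)
    (hΔ : IsDiscretelyLindelof (coDiagonal X)) {S : Set (X × X)}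
    (hS : ∀ p ∈ S, ∃ K ∈ C, p.1 ∈ K ∧ p.2 ∈ K)
    (hT : ∀ T ⊆ S, T.Countable → IsCountablySeparated (outerClosure F C T)) :
    IsCountablySeparated S := by
  by_contra hcon
  choose! A hA hsep using hT
  have hf : ∀ z : coDiagonal X, ∃ f : C(X, ℝ), f z.1.1 ≠ f z.1.2 :=
    fun z => exists_continuousMap_ne z.2
  choose f hf using hf
  let W : C(X, ℝ) → Set (coDiagonal X) := fun g => {w | g w.1.1 ≠ g w.1.2}
  have hW : ∀ g, IsOpen (W g) := fun g => (isOpen_ne_apply g).preimage continuous_subtype_val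
  obtain ⟨ι, _, hwf, hunc, hι⟩ := exists_uncountable_wellOrder_countable_Iio
  obtain ⟨r, hrS, hr, hdisc, -⟩ := exists_discrete_sequence hι (U := fun z => W (f z))
    (fun z => hW _) hf
    (Ψ := fun E => closure E ∪ ((⋃ e ∈ E, W (f e)) ∪ ⋃ g ∈ A (Subtype.val '' E), W g))
    (fun E => subset_union_left)
    (fun E e he => (subset_biUnion_of_mem (u := fun z => W (f z)) he).trans
      (subset_union_left.trans subset_union_right))
    (S := Subtype.val ⁻¹' S) (by
      intro 𝓔 h𝓔 hE
      by_contra! hcov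
      refine hcon ((IsCountablySeparated.biUnion
        (S := fun E => Subtype.val '' (closure E ∪
          ((⋃ e ∈ E, W (f e)) ∪ ⋃ g ∈ A (Subtype.val '' E), W g)))
        h𝓔 fun E hE𝓔 => ?_).mono ?_)
      · obtain ⟨hES, hEc, hEd⟩ := hE E hE𝓔
        simp only [image_union, image_iUnion]
        refine (hΔ.isCountablySeparated_closure hEd).union (IsCountablySeparated.union ?_ ?_)
        · exact IsCountablySeparated.biUnion hEc fun e _ =>
            (isCountablySeparated_ne (f e)).mono (by rintro _ ⟨w, hw, rfl⟩ -; exact hw)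
        · exact IsCountablySeparated.biUnion (hA _ (image_subset_iff.2 hES) (hEc.image _))
            fun g _ => (isCountablySeparated_ne g).mono (by rintro _ ⟨w, hw, rfl⟩ -; exact hw)
      · intro p hp hne
        obtain ⟨E, hE𝓔, hz⟩ := hcov ⟨p, hne⟩ hp
        exact mem_biUnion hE𝓔 ⟨_, hz, rfl⟩)
  have hinit : ∀ i, (Subtype.val '' (r '' Iio i)) ⊆ S ∧ (Subtype.val '' (r '' Iio i)).Countable :=
    fun i => ⟨by rintro _ ⟨_, ⟨j, -, rfl⟩, rfl⟩; exact hrS j, ((hι i).image r).image _⟩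
  obtain ⟨A', hA', hsep'⟩ := hΔ.isCountablySeparated_closure hdisc
  have hcover : (univ : Set ι) ⊆ ⋃ g ∈ A', ⋃ n : ℕ,
      {i | 1 / ((n : ℝ) + 1) ≤ |g (r i).1.1 - g (r i).1.2|} := by
    intro i _
    obtain ⟨g, hg, hgi⟩ := hsep' (r i).1 ⟨r i, subset_closure ⟨i, rfl⟩, rfl⟩ (r i).2
    obtain ⟨n, hn⟩ := exists_nat_one_div_lt (abs_pos.2 (sub_ne_zero.2 hgi))
    exact mem_biUnion hg (mem_iUnion.2 ⟨n, hn.le⟩)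
  -- A uniform gap for one `g` on uncountably many terms keeps their cluster point off the diagonal.
  obtain ⟨g, n, hI⟩ : ∃ g : C(X, ℝ), ∃ n : ℕ,
      ¬ {i | 1 / ((n : ℝ) + 1) ≤ |g (r i).1.1 - g (r i).1.2|}.Countable := by
    by_contra! hcount
    exact not_countable_univ ((hA'.biUnion fun g _ =>
      countable_iUnion fun n => hcount g n).mono hcover)
  set I := {i | 1 / ((n : ℝ) + 1) ≤ |g (r i).1.1 - g (r i).1.2|} with hIdef
  have hlI : (cocountable ⊓ 𝓟 I : Filter ι).NeBot := by
    rw [inf_principal_neBot_iff]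
    intro V hV
    by_contra hemp
    rw [not_nonempty_iff_eq_empty, ← disjoint_iff_inter_eq_empty] at hemp
    exact hI ((mem_cocountable.1 hV).mono hemp.subset_compl_left)
  have hci : CountableInterFilter (cocountable : Filter ι) :=
    cardinalInterFilter_aleph_one_iff.1 inferInstance
  obtain ⟨K, hK, x, hx, y, hy, hne⟩ := h.exists_clusterPt
    (map (fun i => (r i).1) (cocountable ⊓ 𝓟 I)) 
    (eventually_map.2 (Eventually.of_forall fun i => hS _ (hrS i)))
  have hfreq : ∀ V ∈ outerNhds F K x ×ˢ outerNhds F K y, ∀ Γ : Set ι, Γ.Countable →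
      ∃ i ∈ I, i ∉ Γ ∧ (r i).1 ∈ V := by
    intro V hV Γ hΓ
    rw [inf_neBot_iff_frequently_right] at hne
    have h1 := frequently_map.1 (hne hV)
    have h2 : ∀ᶠ i in cocountable ⊓ 𝓟 I, i ∈ I ∧ i ∉ Γ :=
      inter_mem (mem_inf_of_right (mem_principal_self I))
        (mem_inf_of_left (mem_cocountable.2 (by rwa [compl_compl])) : Γᶜ ∈ cocountable ⊓ 𝓟 I)
    obtain ⟨i, hiV, hiI, hiΓ⟩ := (h1.and_eventually h2).exists
    exact ⟨i, hiI, hiΓ, hiV⟩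
  have hle : outerNhds F K x ×ˢ outerNhds F K y ≤ 𝓝 (x, y) := by
    rw [nhds_prod_eq]
    exact prod_mono inf_le_left inf_le_left
  have hxy : x ≠ y := by
    rintro rfl
    have hV : {p : X × X | |g p.1 - g p.2| < 1 / ((n : ℝ) + 1)} ∈ 𝓝 (x, x) := by
      refine (isOpen_lt (by fun_prop) continuous_const).mem_nhds ?_
      simp only [mem_ofPred_eq, sub_self, abs_zero]
      positivity
    obtain ⟨i, hiI, -, hi⟩ := hfreq _ (hle hV) ∅ countable_empty
    exact (not_le.2 (mem_ofPred_eq ▸ hi)) hiI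
  have := h.isCountablyGenerated_outerNhds hΔ hK x
  have := h.isCountablyGenerated_outerNhds hΔ hK y
  obtain ⟨B, hB⟩ := (outerNhds F K x ×ˢ outerNhds F K y).exists_antitone_basis
  choose β _ _ hβ using fun k => hfreq (B k) (hB.1.mem_of_mem trivial) ∅ countable_empty
  -- Countable sets of indices are bounded, so one countable segment already has the cluster point
  -- in its refined closure.
  obtain ⟨i, hi⟩ : ∃ i, ∀ k, β k < i := by
    by_contra! hbd
    refine not_countable_univ ((countable_iUnion fun k => (hι (β k)).insert (β k)).mono
      fun i _ => ?_)
    obtain ⟨k, hk⟩ := hbd i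
    exact mem_iUnion.2 ⟨k, by rw [Iio_insert]; exact hk⟩
  have hmem : (x, y) ∈ outerClosure F C (Subtype.val '' (r '' Iio i)) := by
    refine ⟨K, hK, hx, hy, ?_⟩
    rw [hB.1.inf_principal_neBot_iff]
    exact fun {k} _ => ⟨(r (β k)).1, hβ k, _, ⟨β k, hi k, rfl⟩, rfl⟩
  obtain ⟨f', hf', hfxy⟩ := hsep _ (hinit i).1 (hinit i).2 _ hmem hxy
  -- Uncountably many terms cluster at `(x, y)`, so one with index at least `i` is separated by
  -- `f'`, which the recursion forbids.
  obtain ⟨j, -, hji, hj⟩ := hfreq _ (hle ((isOpen_ne_apply f').mem_nhds hfxy)) _ (hι i)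
  exact hr j i (not_lt.1 hji) (Or.inr (Or.inr (mem_biUnion hf' hj)))

/-- The pairs with both coordinates adherent to a countable set `Q` in the refined topology are
countably separated. -/
theorem isCountablySeparated_adherent [T35Space X] (h : IsSigmaNetwork F C)
    (hΔ : IsDiscretelyLindelof (coDiagonal X)) {Q : Set X} (hQ : Q.Countable) :
    IsCountablySeparated {p : X × X | ∃ K ∈ C, p.1 ∈ K ∧ p.2 ∈ K ∧
      (outerNhds F K p.1 ⊓ 𝓟 Q).NeBot ∧ (outerNhds F K p.2 ⊓ 𝓟 Q).NeBot} := by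
  set S := {p : X × X | ∃ K ∈ C, p.1 ∈ K ∧ p.2 ∈ K ∧
      (outerNhds F K p.1 ⊓ 𝓟 Q).NeBot ∧ (outerNhds F K p.2 ⊓ 𝓟 Q).NeBot} with hS
  obtain ⟨A, hA, hsep⟩ := IsCountablySeparated.of_countable (hQ.prod hQ)
  obtain ⟨ρ, hρ⟩ := exists_continuousMap_eq_zero_iff hA
  -- Where `ρ p ≠ 0` the functions in `A` suffice; only its off-diagonal zeros need the reduction.
  have hmain : IsCountablySeparated {p ∈ S | ρ p = 0 ∧ p.1 ≠ p.2} := by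
    refine h.isCountablySeparated_of_outerClosure hΔ
      (fun p ⟨⟨K, hK, h1, h2, _⟩, _⟩ => ⟨K, hK, h1, h2⟩) fun T hTS hT => ?_
    have hTK : ∀ p ∈ T, ∃ K ∈ C,
        (outerNhds F K p.1 ⊓ 𝓟 Q).NeBot ∧ (outerNhds F K p.2 ⊓ 𝓟 Q).NeBot := fun p hp => by
      obtain ⟨⟨K, hK, -, -, h1⟩, -⟩ := hTS hp
      exact ⟨K, hK, h1⟩
    choose! K hKC hK1 hK2 using hTK
    let g : X × X → Filter (X × X) := fun p =>
      (outerNhds F (K p) p.1 ⊓ 𝓟 Q) ×ˢ (outerNhds F (K p) p.2 ⊓ 𝓟 Q)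
    have hg : ∀ p, g p ≤ 𝓝 p := fun p => by
      rw [nhds_prod_eq]
      exact prod_mono (inf_le_left.trans inf_le_left) (inf_le_left.trans inf_le_left)
    obtain ⟨E, hE, hTE⟩ := exists_isDiscrete_subset_closure ρ hT (fun p hp => (hTS hp).2.1) g
      (fun p _ => hg p) (fun p hp => by
        have := hK1 p hp
        have := hK2 p hp
        infer_instance) (fun p hp => by
        have := h.isCountablyGenerated_outerNhds hΔ (hKC p hp) p.1
        have := h.isCountablyGenerated_outerNhds hΔ (hKC p hp) p.2
        infer_instance) (fun p hp => by
        have h1 : ∀ᶠ q in g p, q ∈ Q ×ˢ Q := prod_mem_prod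
          (mem_inf_of_right (mem_principal_self Q)) (mem_inf_of_right (mem_principal_self Q))
        have h2 : ∀ᶠ q in g p, q.1 ≠ q.2 :=
          hg p (isClosed_diagonal.isOpen_compl.mem_nhds (hTS hp).2.2)
        filter_upwards [h1, h2] with q hq hne
        refine ⟨lt_of_le_of_ne (hρ q).1 fun h0 => ?_, hne⟩
        obtain ⟨f, hf, hfq⟩ := hsep q hq hne
        exact hfq ((hρ q).2.1 h0.symm f hf))
    refine (hΔ.isCountablySeparated_closure hE).mono fun p hp hne => ?_
    obtain ⟨K', -, -, -, hp⟩ := hp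
    refine ⟨⟨p, hne⟩, closure_subtype.2 ?_, rfl⟩
    refine closure_minimal hTE isClosed_closure (mem_closure_iff_clusterPt.2 (hp.mono ?_))
    refine inf_le_inf_right _ ?_
    rw [nhds_prod_eq]
    exact prod_mono inf_le_left inf_le_left
  refine (hmain.union ⟨A, hA, fun p (hp : ρ p ≠ 0) _ => ?_⟩).mono (T := _ ∪ {p | ρ p ≠ 0})
    fun p hp hne => ?_
  · by_contra! hcon
    exact hp ((hρ p).2.2 hcon)
  · by_cases h0 : ρ p = 0
    · exact Or.inl ⟨hp, h0, hne⟩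
    · exact Or.inr h0

theorem isCountablySeparated [T35Space X] (h : IsSigmaNetwork F C)
    (hΔ : IsDiscretelyLindelof (coDiagonal X)) :
    IsCountablySeparated {p : X × X | ∃ K ∈ C, p.1 ∈ K ∧ p.2 ∈ K} := by
  refine h.isCountablySeparated_of_outerClosure hΔ (fun p hp => hp) fun T _ hT => ?_
  refine (h.isCountablySeparated_adherent hΔ
    (Q := Prod.fst '' T ∪ Prod.snd '' T) ((hT.image _).union (hT.image _))).mono ?_
  rintro p ⟨K, hK, h1, h2, hne⟩ -
  have hle : outerNhds F K p.1 ×ˢ outerNhds F K p.2 ⊓ 𝓟 T ≤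
      (outerNhds F K p.1 ⊓ 𝓟 (Prod.fst '' T ∪ Prod.snd '' T)) ×ˢ
        (outerNhds F K p.2 ⊓ 𝓟 (Prod.fst '' T ∪ Prod.snd '' T)) := by
    rw [← prod_inf_prod, prod_principal_principal]
    exact inf_le_inf_left _ (principal_mono.2 fun q hq =>
      ⟨Or.inl (mem_image_of_mem _ hq), Or.inr (mem_image_of_mem _ hq)⟩)
  have := prod_neBot.1 (hne.mono hle)
  exact ⟨K, hK, h1, h2, this.1, this.2⟩

end IsSigmaNetwork

theorem corollary3p26 {X : Type*} [TopologicalSpace X] (hX : IsLindelofSigmaSpace X)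
    (hΔ : IsDiscretelyLindelof (coDiagonal X)) :
    ∃ N : Set (Set X), N.Countable ∧ IsNetwork N := by
  have := hX.tychonoff
  obtain ⟨F, C, hF, hC, hcov, hmod⟩ := hX.exists_network
  have h : IsSigmaNetwork F C := ⟨hF, hC, hcov, hmod⟩
  obtain ⟨N, hN, hnet⟩ := h.exists_countable_network isClosed_univ
    ((h.isCountablySeparated hΔ).mono fun p ⟨K, hK, h1, h2⟩ _ => ⟨K, hK, h1.1, h2.1⟩)
  refine ⟨N, hN, fun U hU => ⟨{A ∈ N | A ⊆ U}, sep_subset _ _, Subset.antisymm ?_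
    (sUnion_subset fun A hA => hA.2)⟩⟩
  intro x hx
  obtain ⟨A, hA, hxA, hAU⟩ := hnet x (mem_univ x) U (hU.mem_nhds hx)
  exact ⟨A, ⟨hA, by simpa using hAU⟩, hxA⟩
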